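/- **Setting.** Let $D\subseteq\mathbb R$, let $\rho$ be a probability measure on $D$, let $\mu=\bigotimes_{n\in\mathbb N}\rho$ on $D^{\mathbb N}$, $\mathbb N=\{1,2,\dots\}$, and let $\mathcal U$ be the set of finite subsets of $\mathbb N$. For a reproducing kernel $K$ let $H(K)$ be its reproducing kernel Hilbert space and $B(K)$ the closed unit ball of $H(K)$. Let $k\ne 0$ be a measurable reproducing kernel on $D\times D$ with $H(k)\cap H(1)=\{0\}$, $M:=\int_D k(x,x)\,\rho(dx)<\infty$, $\int_D k(x,y)\,\rho(dx)=0$ for all $y\in D$, and $k(x,x)>0$ for all $x\in D$. Let $(\gamma_u)_{u\in\mathcal U}$ be non-negative weights (otherwise arbitrary) with $\gamma_\emptyset=1$ and $\sum_{u}\gamma_uM^{|u|}<\infty$. Put $k_u(\mathbf x,\mathbf y)=\prod_{j\in u}k(x_j,y_j)$, $K_v=\sum_{u\subseteq v}\gamma_uk_u$ on $D^{\mathbb N}$, $\mathfrak X=\{\mathbf x\in D^{\mathbb N}:\sum_u\gamma_uk_u(\mathbf x,\mathbf x)<\infty\}$ and $K=\sum_{u\in\mathcal U}\gamma_uk_u$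 on $\mathfrak X$; functions in $H(K)$ are extended by $0$ to $D^{\mathbb N}$. Let $I(f)=\int f\,d\mu$. For $v\in\mathcal U$ and $\mathbf a\in\mathfrak X$ let $(\Psi_{v,\mathbf a}f)(\mathbf x)=f(\mathbf x_v;\mathbf a)$, where $(\mathbf x_v;\mathbf a)$ has the coordinates $x_j$ for $j\in v$ and $a_j$ for $j\notin v$, let $\|\Psi_{v,\mathbf a}\|$ be its operator norm from $H(K)$ to $H(K_v)$, and let $b_{v,\mathbf a}=\sup_{f\in B(K)}|I(f)-I(\Psi_{v,\mathbf a}f)|$. **Algorithms, cost and error.** A randomized algorithm on a class $F$ of functions on $D^{\mathbb N}$ is a random choice (on some probability space) of a deterministic algorithm which sequentially evaluates the integrand, where the next sample point, the decision to stop and the output are arbitrary functions of the values observed so far (so it may be adaptive and nonlinear); for each $f\in F$ it terminates almost surely, and the number of evaluations, the sample points and the output $Q(f)$ are random variables. For $c:D^{\mathbb N}\to[0,\infty]$ let $\mathrm{cost}_c(Q,f)$ be the sum of $c$ over the sample points used on input $f$. Put $e(Q,F)=\big(\sup_{f\in F}\mathbb E\,(I(f)-Q(f))^2\big)^{1/2}$.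 For a set $C$ of such cost functions the $N$th minimal error is $$\inf\Big\{e(Q,F)\;:\;\inf_{c\in C}\sup_{f\in F}\mathbb E\,\mathrm{cost}_c(Q,f)\le N\Big\}.$$ It is denoted by $e_N(F)$ if $C$ consists of the constant function $1$ only. Let $\$:\{0,1,2,\dots\}\to[0,\infty)$ be non-decreasing, let $\mathcal A\subseteq\mathfrak X$ be the set of admissible anchors (for instance $\mathcal A=\mathfrak X$ or $\mathcal A=\{\mathbf a\}$), and let $\mathfrak X_{v,\mathbf a}=\{\mathbf x\in D^{\mathbb N}:x_j=a_j\text{ for all }j\notin v\}$. The minimal error is denoted by $e_{N,\mathrm{fix}}(F)$ if $C$ consists of all functions $c_{v,\mathbf a}$ with $v\in\mathcal U$, $\mathbf a\in\mathcal A$, where $c_{v,\mathbf a}(\mathbf x)=\$(|v|)$ for $\mathbf x\in\mathfrak X_{v,\mathbf a}$ and $c_{v,\mathbf a}(\mathbf x)=\infty$ otherwise; and by $e_{N,\mathrm{var}}(F)$ if $C$ consists of all functions $c(\mathbf x)=\inf\{\$(|v_i|):\mathbf x\in\mathfrak X_{v_i,\mathbf a}\}$ (with $\inf\emptyset=\infty$),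 where $v_1\subsetneq v_2\subsetneq\cdots$ are non-empty sets in $\mathcal U$ and $\mathbf a\in\mathcal A$. **Theorem.** Assume that for some $s>0$ there is a $c>0$ with $\$(\nu)\ge c\,\nu^s$ for all $\nu\in\{0,1,2,\dots\}$, and that for some $p>1$ and $\sigma>0$ there is a $c>0$ with $$\frac{b_{v,\mathbf a}}{1+\|\Psi_{v,\mathbf a}\|}\ \ge\ c\,|v|^{\sigma(1-p)/2}\qquad\text{for all non-empty }v\in\mathcal U\text{ and all }\mathbf a\in\mathcal A.$$ Assume further that $\gamma_{\{1\}}>0$ and that $e_N(B(K_{\{1\}}))^2=\Omega(N^{-\alpha})$ as $N\to\infty$ for some $\alpha>0$. Then, as $N\to\infty$, $$e_{N,\mathrm{fix}}(B(K))^2=\Omega\Big(N^{-\frac{\alpha\sigma(p-1)}{\alpha s+\sigma(p-1)}}\Big)\qquad\text{and}\qquad e_{N,\mathrm{var}}(B(K))^2=\Omega\Big(N^{-\min\{\alpha,\ \sigma(p-1)/s\}}\Big).$$ -/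

import Mathlib

open MeasureTheory Filter
open scoped NNReal ENNReal

noncomputable section

namespace InfDimIntegration

/-! ### Reproducing kernel Hilbert spaces -/

/-- A real-valued kernel, regarded as an operator-valued kernel (a real number acts on `ℝ` by
multiplication). -/
def kernelOp {X : Type*} (K : X → X → ℝ) : Matrix X X (ℝ →L[ℝ] ℝ) :=
  Matrix.of fun x y => K x y • ContinuousLinearMap.id ℝ ℝ

/-- The norm `‖f‖_K` of a function `f : X → ℝ` in the reproducing kernel Hilbert space `H(K)`;
it is `∞` if `f` does not belong to `H(K)`. (The infimum runs over at most one element, since the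
elements of `H(K)` are determined by the functions they represent.) -/
def rkhsNorm {X : Type*} (K : X → X → ℝ) (f : X → ℝ) : ℝ≥0∞ :=
  ⨅ (_ : Fact (kernelOp K).PosSemidef) (h : RKHS.OfKernel (kernelOp K)) (_ : ⇑h = f), ‖h‖ₑ

/-- The functions that belong to `H(K)`. -/
def rkhs {X : Type*} (K : X → X → ℝ) : Set (X → ℝ) := {f | rkhsNorm K f < ∞}

/-- The closed unit ball `B(K)` of `H(K)`. -/
def rkhsBall {X : Type*} (K : X → X → ℝ) : Set (X → ℝ) := {f | rkhsNorm K f ≤ 1}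

/-! ### Deterministic and randomized algorithms -/

/-- A deterministic, possibly adaptive and nonlinear algorithm that uses finitely many function
values: depending on the list of the values observed so far, it either stops and returns a number,
or it evaluates the integrand at a further point. -/
structure DetAlgorithm (X : Type*) where
  /-- the next sample point -/
  node : List ℝ → X
  /-- the stopping rule -/
  halt : List ℝ → Prop
  /-- the output -/
  out : List ℝ → ℝ

namespace DetAlgorithm

variable {X : Type*} (A : DetAlgorithm X) (f : X → ℝ)

/-- The first `n` function values observed on input `f` (disregarding the stopping rule). -/
def values : ℕ → List ℝ
  | 0 => []
  | n + 1 => values n ++ [f (A.node (values n))]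

/-- The sample point number `i` on input `f`, starting with number `0`. -/
def point (i : ℕ) : X := A.node (A.values f i)

/-- The algorithm terminates on input `f`. -/
def Halts : Prop := ∃ n, A.halt (A.values f n)

/-- The number of function evaluations on an input `f` on which the algorithm terminates. -/
def count : ℕ := sInf {n | A.halt (A.values f n)}

/-- The output on an input `f` on which the algorithm terminates. -/
def result : ℝ := A.out (A.values f (A.count f))

/-- The sum of the costs of all function evaluations on input `f`, if an evaluation at `x` costs
`c x`. -/
def cost (c : X → ℝ≥0∞) : ℝ≥0∞ := ∑ i ∈ Finset.range (A.count f), c (A.point f i)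

end DetAlgorithm

/-- A randomized algorithm on the class `F` of functions on `X`: a random choice of a deterministic
algorithm that, for each `f ∈ F`, terminates almost surely and has a random number of evaluations,
random sample points and a random output that depend measurably on the random element. -/
structure RandomizedAlgorithm {X : Type*} [MeasurableSpace X] (F : Set (X → ℝ)) where
  /-- the underlying probability space -/
  Ω : Type
  [measurableSpace : MeasurableSpace Ω]
  /-- the underlying probability measure -/
  P : Measure Ω
  [isProbabilityMeasure : IsProbabilityMeasure P]
  /-- the random deterministic algorithm -/
  alg : Ω → DetAlgorithm X
  halts : ∀ f ∈ F, ∀ᵐ ω ∂P, (alg ω).Halts f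
  measurableSet_point : ∀ f ∈ F, ∀ i : ℕ, ∀ B : Set X, MeasurableSet B →
    MeasurableSet {ω | i < (alg ω).count f ∧ (alg ω).point f i ∈ B}
  measurable_result : ∀ f ∈ F, Measurable fun ω => (alg ω).result f

attribute [instance] RandomizedAlgorithm.measurableSpace RandomizedAlgorithm.isProbabilityMeasure

namespace RandomizedAlgorithm

variable {X : Type*} [MeasurableSpace X] {F : Set (X → ℝ)} (Q : RandomizedAlgorithm F)

/-- The worst case expected cost `sup_{f ∈ F} E(cost_c(Q, f))`. -/
def expectedCost (c : X → ℝ≥0∞) : ℝ≥0∞ := ⨆ f ∈ F, ∫⁻ ω, (Q.alg ω).cost f c ∂Q.P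

/-- The worst case cost with respect to a set `C` of admissible cost functions. -/
def worstCaseCost (C : Set (X → ℝ≥0∞)) : ℝ≥0∞ := ⨅ c ∈ C, Q.expectedCost c

/-- The randomized error `e(Q, F)` of approximating the functional `I` by `Q` on `F`. -/
def error (I : (X → ℝ) → ℝ) : ℝ≥0∞ :=
  (⨆ f ∈ F, ∫⁻ ω, ENNReal.ofReal ((I f - (Q.alg ω).result f) ^ 2) ∂Q.P) ^ (1 / 2 : ℝ)

end RandomizedAlgorithm

/-- The `N`th minimal error of approximating `I` on `F` by randomized algorithms with worst case
cost at most `N` with respect to the set `C` of admissible cost functions. -/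
def minimalError {X : Type*} [MeasurableSpace X] (C : Set (X → ℝ≥0∞)) (I : (X → ℝ) → ℝ)
    (F : Set (X → ℝ)) (N : ℝ≥0) : ℝ≥0∞ :=
  ⨅ (Q : RandomizedAlgorithm F) (_ : Q.worstCaseCost C ≤ N), Q.error I

/-! ### Weighted spaces of functions of infinitely many variables -/

section Spaces

variable {D : Set ℝ} (ρ : Measure D) (k : D → D → ℝ) (γ : Finset ℕ+ → ℝ)

/-- The kernel `k_u` on `D^ℕ`. -/
def tensorKernel (u : Finset ℕ+) (x y : ℕ+ → D) : ℝ := ∏ j ∈ u, k (x j) (y j)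

/-- The weighted kernel `K_v` on `D^ℕ`, for a finite set `v` of coordinates. -/
def partialKernel (v : Finset ℕ+) (x y : ℕ+ → D) : ℝ :=
  ∑ u ∈ v.powerset, γ u * tensorKernel k u x y

/-- The domain `𝔛 ⊆ D^ℕ` of functions of infinitely many variables. -/
def domain : Set (ℕ+ → D) := {x | Summable fun u : Finset ℕ+ => γ u * tensorKernel k u x x}

/-- The kernel `K` on `𝔛`. -/
def fullKernel (x y : domain k γ) : ℝ :=
  ∑' u : Finset ℕ+, γ u * tensorKernel k u (x : ℕ+ → D) (y : ℕ+ → D)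

/-- The unit ball `B(K)`, whose elements are extended by zero from `𝔛` to `D^ℕ`. -/
def fullBall : Set ((ℕ+ → D) → ℝ) :=
  (fun g : domain k γ → ℝ => Function.extend Subtype.val g 0) '' rkhsBall (fullKernel k γ)

/-- Integration with respect to the product measure `ρ^ℕ`. -/
def integral (f : (ℕ+ → D) → ℝ) : ℝ := ∫ x, f x ∂(Measure.infinitePi fun _ : ℕ+ => ρ)

/-- The standing assumptions on the kernel `k` and on the weights `γ`. -/
structure StandingAssumptions : Prop where
  kernel_ne_zero : k ≠ 0
  measurable_kernel : Measurable (Function.uncurry k)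
  posSemidef_kernel : (Matrix.of k).PosSemidef
  rkhs_inter_constants : rkhs k ∩ rkhs (fun _ _ : D => (1 : ℝ)) = {0}
  integrable_diagonal : Integrable (fun x => k x x) ρ
  integral_kernel : ∀ y, ∫ x, k x y ∂ρ = 0
  diagonal_pos : ∀ x, 0 < k x x
  weight_nonneg : ∀ u, 0 ≤ γ u
  weight_empty : γ ∅ = 1
  summable_weights : Summable fun u : Finset ℕ+ => γ u * (∫ x, k x x ∂ρ) ^ u.card

/-- The projection `Ψ_{v,a}`: the coordinates outside of `v` are frozen at the anchor `a`. -/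
def anchorProj (v : Finset ℕ+) (a : ℕ+ → D) (f : (ℕ+ → D) → ℝ) : (ℕ+ → D) → ℝ :=
  fun x => f fun j => if j ∈ v then x j else a j

/-- The operator norm of `Ψ_{v,a} : H(K) → H(K_v)`. -/
def anchorProjNorm (v : Finset ℕ+) (a : ℕ+ → D) : ℝ≥0∞ :=
  ⨆ f ∈ fullBall k γ, rkhsNorm (partialKernel k γ v) (anchorProj v a f)

/-- The quantity `b_{v,a} = sup_{f ∈ B(K)} |I(f) - I(Ψ_{v,a} f)|`. -/
def bias (v : Finset ℕ+) (a : ℕ+ → D) : ℝ≥0∞ :=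
  ⨆ f ∈ fullBall k γ, ‖integral ρ f - integral ρ (anchorProj v a f)‖ₑ

/-! ### Cost models -/

/-- The affine subspace `𝔛_{v,a}`. -/
def affineSubspace (v : Finset ℕ+) (a : ℕ+ → D) : Set (ℕ+ → D) := {x | ∀ j, j ∉ v → x j = a j}

open Classical in
/-- The cost function `c_{v,a}` of fixed subspace sampling. -/
def fixedCost (price : ℕ → ℝ≥0) (v : Finset ℕ+) (a : ℕ+ → D) (x : ℕ+ → D) : ℝ≥0∞ :=
  if x ∈ affineSubspace v a then (price v.card : ℝ≥0∞) else ∞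

/-- The cost function of variable subspace sampling for a sequence `v` of sets of coordinates. -/
def variableCost (price : ℕ → ℝ≥0) (v : ℕ → Finset ℕ+) (a : ℕ+ → D) (x : ℕ+ → D) : ℝ≥0∞ :=
  ⨅ (i : ℕ) (_ : x ∈ affineSubspace (v i) a), (price (v i).card : ℝ≥0∞)

/-- All cost functions of fixed subspace sampling with anchors from the set `A`. -/
def fixedCosts (price : ℕ → ℝ≥0) (A : Set (ℕ+ → D)) : Set ((ℕ+ → D) → ℝ≥0∞) :=
  {c | ∃ v : Finset ℕ+, ∃ a ∈ A, c = fixedCost price v a}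

/-- All cost functions of variable subspace sampling with anchors from the set `A`. -/
def variableCosts (price : ℕ → ℝ≥0) (A : Set (ℕ+ → D)) : Set ((ℕ+ → D) → ℝ≥0∞) :=
  {c | ∃ v : ℕ → Finset ℕ+, StrictMono v ∧ (∀ i, (v i).Nonempty) ∧
    ∃ a ∈ A, c = variableCost price v a}

/-- The minimal errors `e_{N,fix}(B(K))` for the set `A` of admissible anchors. -/
def fixedMinimalError (price : ℕ → ℝ≥0) (A : Set (ℕ+ → D)) (N : ℝ≥0) : ℝ≥0∞ :=
  minimalError (fixedCosts price A) (integral ρ) (fullBall k γ) N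

/-- The minimal errors `e_{N,var}(B(K))` for the set `A` of admissible anchors. -/
def variableMinimalError (price : ℕ → ℝ≥0) (A : Set (ℕ+ → D)) (N : ℝ≥0) : ℝ≥0∞ :=
  minimalError (variableCosts price A) (integral ρ) (fullBall k γ) N

/-- The minimal errors `e_N(B(K_v))`, where every function evaluation has cost one. -/
def partialMinimalError (v : Finset ℕ+) (N : ℝ≥0) : ℝ≥0∞ :=
  minimalError {fun _ => 1} (integral ρ) (rkhsBall (partialKernel k γ v)) N

end Spaces

/-- `e(N) = Ω(N ^ (-r))` for `N → ∞`. -/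
def IsOmegaRpowNeg (e : ℝ≥0 → ℝ≥0∞) (r : ℝ) : Prop :=
  ∃ c : ℝ, 0 < c ∧ ∀ᶠ N : ℝ≥0 in atTop, ENNReal.ofReal (c * (N : ℝ) ^ (-r)) ≤ e N

end InfDimIntegration

end

open MeasureTheory Filter
open scoped NNReal ENNReal

noncomputable section

/-! Two lower bounds hold for every randomized algorithm on $B(K)$; put $t=\sigma(p-1)$. Bias:
suppose sampling outside $\mathfrak X_{v,a}$ costs at least $T$ and the expected cost is at most
$T/2$. By Markov's inequality, with probability at least $1/2$ all sample points lie in $\mathfrak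
X_{v,a}$. For $f\in B(K)$ the function $h=(f-\Psi_{v,a}f)/(1+\|\Psi_{v,a}\|)$ vanishes there, and
$\pm h\in B(K)$, so the algorithm cannot tell $h$ from $-h$. The squared error is therefore at least
$\frac12\big(b_{v,a}/(1+\|\Psi_{v,a}\|)\big)^2$, which is of order at least $|v|^{-t}$
(`ofReal_sq_le_error_sq_of_affineSubspace`). Univariate integration: $H(K_{\{1\}})$ embeds
contractively into $H(K)$ and $\mathfrak X$ has full measure. If each evaluation costs at least $T$,
an algorithm of cost $M$ thus also integrates over $B(K_{\{1\}})$ with $M/T$ expected evaluations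
(`partialMinimalError_le_error`). For fixed subspaces of dimension $m$ the bounds are $m^{-t}$ and
$(N/m^s)^{-\alpha}$, up to constants and for enough samples; balancing them over $m$ gives the rate.
For variable subspaces an evaluation costs at least a constant, which gives $N^{-\alpha}$, and a
budget of order $N$ reaches dimension of order at most $N^{1/s}$, which gives $N^{-t/s}$. -/

namespace InfDimIntegration

/-! ### Reproducing kernel Hilbert spaces: comparison of norms, pointwise bounds, measurability. -/

section ReproducingKernels

variable {X Y : Type*} {K : X → X → ℝ} {L : Y → Y → ℝ}

theorem posSemidef_kernelOp (hK : (Matrix.of K).PosSemidef) : (kernelOp K).PosSemidef := by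
  have key := (RKHS.posSemidef_tfae (𝕜 := ℝ) (K := kernelOp K)).out 0 2
  refine key.mpr ⟨?_, fun c => ?_⟩
  · ext x y
    have := hK.isHermitian.apply x y
    simp only [Matrix.of_apply, star_trivial] at this
    simp [kernelOp, this, show ContinuousLinearMap.id ℝ ℝ = 1 from rfl]
  · have := hK.2 c
    simp only [Matrix.of_apply, star_trivial] at this
    rw [Finsupp.sum_comm]
    simpa [kernelOp, mul_comm, mul_assoc, mul_left_comm] using this

theorem rkhsNorm_coe [hK : Fact (kernelOp K).PosSemidef] (h : RKHS.OfKernel (kernelOp K)) :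
    rkhsNorm K ⇑h = ‖h‖ₑ := by
  refine le_antisymm (iInf_le_of_le hK (iInf_le_of_le h (iInf_le_of_le rfl le_rfl))) ?_
  refine le_iInf fun _ => le_iInf fun g => le_iInf fun hg => ?_
  rw [DFunLike.coe_injective hg]

theorem exists_coe_eq_of_rkhsNorm_lt_top {f : X → ℝ} (hf : rkhsNorm K f < ∞) :
    ∃ (_ : Fact (kernelOp K).PosSemidef) (h : RKHS.OfKernel (kernelOp K)), ⇑h = f := by
  simp only [rkhsNorm, iInf_lt_iff] at hf
  obtain ⟨h1, h2, h3, -⟩ := hf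
  exact ⟨h1, h2, h3⟩

theorem rkhsNorm_sub_le (f g : X → ℝ) : rkhsNorm K (f - g) ≤ rkhsNorm K f + rkhsNorm K g := by
  by_cases hf : rkhsNorm K f < ∞
  · by_cases hg : rkhsNorm K g < ∞
    · obtain ⟨hK, f, rfl⟩ := exists_coe_eq_of_rkhsNorm_lt_top hf
      obtain ⟨-, g, rfl⟩ := exists_coe_eq_of_rkhsNorm_lt_top hg
      rw [← RKHS.coe_sub, rkhsNorm_coe, rkhsNorm_coe, rkhsNorm_coe]
      exact enorm_sub_le
    · simp [not_lt_top_iff.mp hg]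
  · simp [not_lt_top_iff.mp hf]

theorem rkhsNorm_smul_le (c : ℝ) {f : X → ℝ} (hf : rkhsNorm K f < ∞) :
    rkhsNorm K (c • f) ≤ ‖c‖ₑ * rkhsNorm K f := by
  obtain ⟨hK, f, rfl⟩ := exists_coe_eq_of_rkhsNorm_lt_top hf
  rw [← RKHS.coe_smul, rkhsNorm_coe, rkhsNorm_coe, enorm_smul]

theorem neg_mem_rkhsBall {f : X → ℝ} (hf : f ∈ rkhsBall K) : -f ∈ rkhsBall K := by
  have h := rkhsNorm_smul_le (K := K) (-1) (lt_of_le_of_lt hf ENNReal.one_lt_top)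
  rw [neg_one_smul] at h
  exact h.trans (by simpa [rkhsBall] using hf)

section OfKernel

variable [Fact (kernelOp K).PosSemidef]

theorem kerFun_one_apply (x y : X) :
    RKHS.kerFun (RKHS.OfKernel (kernelOp K)) y (1 : ℝ) x = K x y := by
  rw [RKHS.kerFun_apply, RKHS.OfKernel.kernel_ofKernel]
  simp [kernelOp]

theorem abs_coe_le (h : RKHS.OfKernel (kernelOp K)) (x : X) : |h x| ≤ ‖h‖ * √(K x x) := by
  have h1 := RKHS.norm_apply_le h x
  rw [RKHS.OfKernel.kernel_ofKernel] at h1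
  have h2 : 0 ≤ K x x := by
    rw [← kerFun_one_apply (K := K) x x]
    have h3 := RKHS.kerFun_inner x (1 : ℝ) (RKHS.kerFun (RKHS.OfKernel (kernelOp K)) x (1 : ℝ))
    simp only [RCLike.inner_apply, map_one, mul_one] at h3
    rw [← h3]
    exact real_inner_self_nonneg
  simpa [kernelOp, norm_smul, abs_of_nonneg h2] using h1

/-- Finite linear combinations of the kernel sections. -/
def kernelCombination (K : X → X → ℝ) [Fact (kernelOp K).PosSemidef] :
    (X →₀ ℝ) →ₗ[ℝ] RKHS.OfKernel (kernelOp K) :=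
  Finsupp.linearCombination ℝ fun x => RKHS.kerFun (RKHS.OfKernel (kernelOp K)) x (1 : ℝ)

theorem denseRange_kernelCombination : DenseRange (kernelCombination K) := by
  have h := RKHS.kerFun_dense (RKHS.OfKernel (kernelOp K))
  rw [← Submodule.dense_iff_topologicalClosure_eq_top] at h
  refine h.mono ?_
  rw [← LinearMap.coe_range, kernelCombination, Finsupp.range_linearCombination,
    SetLike.coe_subset_coe, Submodule.span_le]
  rintro _ ⟨x, v, rfl⟩
  have : RKHS.kerFun (RKHS.OfKernel (kernelOp K)) x v
      = v • RKHS.kerFun (RKHS.OfKernel (kernelOp K)) x (1 : ℝ) := by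
    rw [← map_smul, smul_eq_mul, mul_one]
  rw [this]
  exact Submodule.smul_mem _ _ (Submodule.subset_span ⟨x, rfl⟩)

theorem norm_kernelCombination_sq (c : X →₀ ℝ) :
    ‖kernelCombination K c‖ ^ 2 = c.sum fun i a => c.sum fun j b => a * K i j * b := by
  rw [← real_inner_self_eq_norm_sq, kernelCombination, Finsupp.linearCombination_apply,
    Finsupp.sum_inner]
  refine Finsupp.sum_congr fun i _ => ?_
  rw [Finsupp.inner_sum, Finsupp.sum, Finsupp.sum]
  refine Finset.sum_congr rfl fun j _ => ?_
  rw [inner_smul_left, inner_smul_right, RKHS.kerFun_inner, kerFun_one_apply]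
  simp
  ring

end OfKernel

/-- Composition with `φ` is a contraction from `H(K)` to `H(L)` if `L - K ∘ φ` is positive
semidefinite. -/
theorem rkhsNorm_comp_le (hL : (Matrix.of L).PosSemidef) (φ : Y → X)
    (hLK : ∀ c : Y →₀ ℝ, (c.sum fun i a => c.sum fun j b => a * K (φ i) (φ j) * b) ≤
      c.sum fun i a => c.sum fun j b => a * L i j * b) (f : X → ℝ) :
    rkhsNorm L (f ∘ φ) ≤ rkhsNorm K f := by
  by_cases hf : rkhsNorm K f < ∞
  swap
  · simp [not_lt_top_iff.mp hf]
  obtain ⟨hK, h, rfl⟩ := exists_coe_eq_of_rkhsNorm_lt_top hf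
  have : Fact (kernelOp L).PosSemidef := ⟨posSemidef_kernelOp hL⟩
  -- `T` encodes the assignment $L(\cdot,y)\mapsto K(\cdot,\varphi(y))$. By `hLK` it is contractive
  -- on the span of the kernel sections, hence extends by density to a contraction `S`; by the
  -- reproducing property the adjoint of `S` is composition with `φ`.
  let T : (Y →₀ ℝ) →ₗ[ℝ] RKHS.OfKernel (kernelOp K) :=
    kernelCombination K ∘ₗ Finsupp.lmapDomain ℝ ℝ φ
  have hT : ∀ c, ‖T c‖ ≤ 1 * ‖kernelCombination L c‖ := fun c => by
    rw [one_mul]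
    refine le_of_sq_le_sq ?_ (norm_nonneg _)
    rw [norm_kernelCombination_sq]
    refine le_trans (le_of_eq ?_) (hLK c)
    simp only [T, LinearMap.comp_apply, norm_kernelCombination_sq, Finsupp.lmapDomain_apply]
    rw [Finsupp.sum_mapDomain_index]
    · refine Finsupp.sum_congr fun i _ => ?_
      rw [Finsupp.sum_mapDomain_index] <;> simp [mul_add]
    · simp
    · simp [add_mul]
  let S := T.extendOfNorm (kernelCombination L)
  have hS : ‖S‖ ≤ 1 :=
    LinearMap.opNorm_extendOfNorm_le (f := T) denseRange_kernelCombination zero_le_one hT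
  have hSx : ∀ y, S (RKHS.kerFun (RKHS.OfKernel (kernelOp L)) y (1 : ℝ))
      = RKHS.kerFun (RKHS.OfKernel (kernelOp K)) (φ y) (1 : ℝ) := fun y => by
    have := LinearMap.extendOfNorm_eq (f := T) denseRange_kernelCombination ⟨1, hT⟩
      (Finsupp.single y 1)
    simpa [S, T, kernelCombination] using this
  have hcoe : ⇑(ContinuousLinearMap.adjoint S h) = ⇑h ∘ φ := by
    ext y
    have h1 := RKHS.inner_kerFun y (1 : ℝ) (ContinuousLinearMap.adjoint S h)
    rw [ContinuousLinearMap.adjoint_inner_left, hSx, RKHS.inner_kerFun] at h1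
    simpa using h1.symm
  rw [← hcoe, rkhsNorm_coe, rkhsNorm_coe, enorm_le_iff_norm_le]
  refine (ContinuousLinearMap.le_opNorm _ _).trans ?_
  rw [LinearIsometryEquiv.norm_map]
  exact mul_le_of_le_one_left (norm_nonneg _) hS

theorem exists_abs_le_of_rkhsNorm_lt_top {f : X → ℝ} (hf : rkhsNorm K f < ∞) :
    ∃ C : ℝ, ∀ x, |f x| ≤ C * √(K x x) := by
  obtain ⟨hK, h, rfl⟩ := exists_coe_eq_of_rkhsNorm_lt_top hf
  exact ⟨‖h‖, abs_coe_le h⟩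

/-- Norm convergence implies pointwise convergence, so each element is a pointwise limit of a
sequence of finite combinations of kernel sections. -/
theorem measurable_of_rkhsNorm_lt_top [MeasurableSpace X] (hK : ∀ y, Measurable fun x => K x y)
    {f : X → ℝ} (hf : rkhsNorm K f < ∞) : Measurable f := by
  obtain ⟨hK', h, rfl⟩ := exists_coe_eq_of_rkhsNorm_lt_top hf
  obtain ⟨u, hu, hlim⟩ := mem_closure_iff_seq_limit.mp (denseRange_kernelCombination (K := K) h)
  refine measurable_of_tendsto_metrizable (f := fun n => ⇑(u n)) (fun n => ?_) ?_
  · obtain ⟨c, hc⟩ := hu n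
    have : ⇑(u n) = fun x => ∑ y ∈ c.support, c y * K x y := by
      ext x
      rw [← hc, kernelCombination, Finsupp.linearCombination_apply, Finsupp.sum,
        ← RKHS.coeCLM_apply, map_sum, Finset.sum_apply]
      simp [kerFun_one_apply]
    rw [this]
    exact Finset.measurable_sum _ fun y _ => (hK y).const_mul _
  · rw [tendsto_pi_nhds]
    exact fun x => ((RKHS.continuous_eval x).tendsto h).comp hlim

/-- The quadratic form is tested on $\delta_x\pm\delta_y$. This form of the bound dominates an
off-diagonal series by two diagonal ones. -/
theorem abs_le_of_posSemidef (hK : (Matrix.of K).PosSemidef) (x y : X) :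
    |K x y| ≤ (K x x + K y y) / 2 := by
  have hsymm : K y x = K x y := by simpa using hK.isHermitian.apply x y
  have key : ∀ t : ℝ, 0 ≤ K x x + 2 * t * K x y + t ^ 2 * K y y := fun t => by
    have h := hK.2 (Finsupp.single x 1 + Finsupp.single y t)
    classical
    rw [Finsupp.sum_add_index'] at h
    · rw [Finsupp.sum_single_index, Finsupp.sum_single_index, Finsupp.sum_add_index',
        Finsupp.sum_add_index'] at h
      · simp [hsymm] at h
        nlinarith
      all_goals simp [mul_add]
    · simp
    · simp [add_mul]
  rw [abs_le]
  constructor <;> nlinarith [key 1, key (-1)]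

end ReproducingKernels

/-! ### The weighted kernels, their domain, and integrability. -/

section WeightedKernels

variable {D : Set ℝ} {ρ : Measure D} {k : D → D → ℝ} {γ : Finset ℕ+ → ℝ}

/-- Schur product theorem, by induction on `u`; for $u=\emptyset$ the quadratic form is the square
of the sum of the coefficients. -/
theorem posSemidef_tensorKernel (hk : (Matrix.of k).PosSemidef) (u : Finset ℕ+) :
    (Matrix.of (tensorKernel k u)).PosSemidef := by
  induction u using Finset.cons_induction with
  | empty =>
    refine ⟨by ext; simp [tensorKernel], fun c => ?_⟩
    have : (c.sum fun i a => c.sum fun j b =>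
        star a * Matrix.of (tensorKernel k ∅) i j * b) = (c.sum fun _ a => a) ^ 2 := by
      simp only [Finsupp.sum, sq, Finset.sum_mul_sum]
      simp [tensorKernel]
    rw [this]
    positivity
  | cons j u hj ih =>
    have := (hk.submatrix fun x : ℕ+ → D => x j).hadamard ih
    have hM : Matrix.of (tensorKernel k (Finset.cons j u hj)) =
        ((Matrix.of k).submatrix (fun x : ℕ+ → D => x j) fun x => x j).hadamard
          (Matrix.of (tensorKernel k u)) := by
      ext x y
      simp [tensorKernel, Finset.prod_insert hj]
    rw [hM]
    exact this

theorem posSemidef_mul_tensorKernel (hk : StandingAssumptions ρ k γ) (u : Finset ℕ+) :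
    (Matrix.of fun x y => γ u * tensorKernel k u x y).PosSemidef :=
  (posSemidef_tensorKernel hk.posSemidef_kernel u).smul (hk.weight_nonneg u)

theorem mul_tensorKernel_diagonal_nonneg (hk : StandingAssumptions ρ k γ) (u : Finset ℕ+)
    (x : ℕ+ → D) : 0 ≤ γ u * tensorKernel k u x x :=
  mul_nonneg (hk.weight_nonneg u) (Finset.prod_nonneg fun _ _ => (hk.diagonal_pos _).le)

theorem summable_mul_tensorKernel (hk : StandingAssumptions ρ k γ) (x y : domain k γ) :
    Summable fun u : Finset ℕ+ => γ u * tensorKernel k u (x : ℕ+ → D) (y : ℕ+ → D) := by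
  refine Summable.of_abs (.of_nonneg_of_le (fun _ => abs_nonneg _)
    (fun u => abs_le_of_posSemidef (posSemidef_mul_tensorKernel hk u) x.1 y.1)
    ((x.2.add y.2).div_const 2))

theorem hasSum_quadraticForm (hk : StandingAssumptions ρ k γ) (c : domain k γ →₀ ℝ) :
    HasSum (fun u : Finset ℕ+ => c.sum fun i a => c.sum fun j b =>
        a * (γ u * tensorKernel k u (i : ℕ+ → D) (j : ℕ+ → D)) * b)
      (c.sum fun i a => c.sum fun j b => a * fullKernel k γ i j * b) :=
  hasSum_sum fun i _ => hasSum_sum fun j _ =>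
    ((summable_mul_tensorKernel hk i j).hasSum.mul_left _).mul_right _

theorem quadraticForm_nonneg (hk : StandingAssumptions ρ k γ) (c : domain k γ →₀ ℝ)
    (u : Finset ℕ+) : 0 ≤ c.sum fun i a => c.sum fun j b =>
        a * (γ u * tensorKernel k u (i : ℕ+ → D) (j : ℕ+ → D)) * b := by
  have := ((posSemidef_mul_tensorKernel hk u).submatrix (Subtype.val : domain k γ → _)).2 c
  simpa using this

theorem posSemidef_fullKernel (hk : StandingAssumptions ρ k γ) :
    (Matrix.of (fullKernel k γ)).PosSemidef := by
  refine ⟨?_, fun c => ?_⟩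
  · ext x y
    simp only [Matrix.conjTranspose_apply, Matrix.of_apply, star_trivial, fullKernel]
    refine tsum_congr fun u => ?_
    simpa using (posSemidef_mul_tensorKernel hk u).isHermitian.apply x.1 y.1
  · simpa using (hasSum_quadraticForm hk c).nonneg fun u => quadraticForm_nonneg hk c u

/-- The restriction from `D^ℕ` to `𝔛` is a contraction from `H(K_v)` to `H(K)`. -/
theorem rkhsNorm_fullKernel_le (hk : StandingAssumptions ρ k γ) (v : Finset ℕ+)
    (f : (ℕ+ → D) → ℝ) : rkhsNorm (fullKernel k γ) (f ∘ Subtype.val)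
      ≤ rkhsNorm (partialKernel k γ v) f := by
  refine rkhsNorm_comp_le (posSemidef_fullKernel hk) _ (fun c => ?_) f
  -- $K-K_v$ is the sum of the positive semidefinite kernels $\gamma_uk_u$ with $u\not\subseteq v$.
  have hle := sum_le_hasSum v.powerset (fun u _ => quadraticForm_nonneg hk c u)
    (hasSum_quadraticForm hk c)
  refine le_trans (le_of_eq ?_) hle
  simp only [Finsupp.sum, partialKernel, Finset.mul_sum, Finset.sum_mul]
  rw [eq_comm, Finset.sum_comm]
  exact Finset.sum_congr rfl fun i _ => Finset.sum_comm

/-- The diagonal of the kernel `K`, with the value `∞` outside of `𝔛`. -/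
def diagonalSum (k : D → D → ℝ) (γ : Finset ℕ+ → ℝ) (x : ℕ+ → D) : ℝ≥0∞ :=
  ∑' u : Finset ℕ+, ENNReal.ofReal (γ u * tensorKernel k u x x)

theorem measurable_tensorKernel {Z : Type*} [MeasurableSpace Z]
    (hk : StandingAssumptions ρ k γ) (u : Finset ℕ+) {g h : Z → ℕ+ → D} (hg : Measurable g)
    (hh : Measurable h) : Measurable fun z => tensorKernel k u (g z) (h z) := by
  refine Finset.measurable_prod _ fun j _ => ?_
  exact hk.measurable_kernel.comp
    (((measurable_pi_apply j).comp hg).prodMk ((measurable_pi_apply j).comp hh))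

theorem measurable_diagonalSum (hk : StandingAssumptions ρ k γ) :
    Measurable (diagonalSum k γ) :=
  Measurable.tsum fun u =>
    ((measurable_tensorKernel hk u measurable_id measurable_id).const_mul _).ennreal_ofReal

theorem mem_domain_iff (hk : StandingAssumptions ρ k γ) (x : ℕ+ → D) :
    x ∈ domain k γ ↔ diagonalSum k γ x < ∞ := by
  constructor
  · intro hx
    rw [diagonalSum, ← ENNReal.ofReal_tsum_of_nonneg
      (fun u => mul_tensorKernel_diagonal_nonneg hk u x) hx]
    exact ENNReal.ofReal_lt_top
  · intro hx
    have := ENNReal.summable_toReal hx.ne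
    simp only [ENNReal.toReal_ofReal (mul_tensorKernel_diagonal_nonneg hk _ x)] at this
    exact this

theorem measurableSet_domain (hk : StandingAssumptions ρ k γ) : MeasurableSet (domain k γ) := by
  have : domain k γ = {x | diagonalSum k γ x < ∞} := by
    ext x
    exact mem_domain_iff hk x
  rw [this]
  exact measurableSet_lt (measurable_diagonalSum hk) measurable_const

/-- By Tonelli and independence of the coordinates the integral equals $\sum_u\gamma_uM^{|u|}$.
Hence $\mathfrak X$ has full measure. -/
theorem lintegral_diagonalSum_lt_top [IsProbabilityMeasure ρ] (hk : StandingAssumptions ρ k γ) :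
    ∫⁻ x, diagonalSum k γ x ∂(Measure.infinitePi fun _ : ℕ+ => ρ) < ∞ := by
  have hdiag : Measurable fun x : D => ENNReal.ofReal (k x x) :=
    (hk.measurable_kernel.comp (measurable_id.prodMk measurable_id)).ennreal_ofReal
  have hterm : ∀ u : Finset ℕ+,
      ∫⁻ x, ENNReal.ofReal (γ u * tensorKernel k u x x) ∂(Measure.infinitePi fun _ : ℕ+ => ρ)
        = ENNReal.ofReal (γ u * (∫ x, k x x ∂ρ) ^ u.card) := fun u => by
    have hM : ENNReal.ofReal (∫ x, k x x ∂ρ) = ∫⁻ x, ENNReal.ofReal (k x x) ∂ρ :=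
      ofReal_integral_eq_lintegral_ofReal hk.integrable_diagonal
        (ae_of_all _ fun x => (hk.diagonal_pos x).le)
    have hM0 : 0 ≤ ∫ x, k x x ∂ρ := integral_nonneg fun x => (hk.diagonal_pos x).le
    rw [ENNReal.ofReal_mul (hk.weight_nonneg u), ENNReal.ofReal_pow hM0, hM]
    simp_rw [ENNReal.ofReal_mul (hk.weight_nonneg u)]
    rw [lintegral_const_mul' _ _ ENNReal.ofReal_ne_top]
    congr 1
    simp_rw [tensorKernel, ENNReal.ofReal_prod_of_nonneg fun j _ => (hk.diagonal_pos _).le]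
    rw [ProbabilityTheory.lintegral_prod_eq_prod_lintegral_of_indepFun u
      (fun j (x : ℕ+ → D) => ENNReal.ofReal (k (x j) (x j)))
      (ProbabilityTheory.iIndepFun_infinitePi (P := fun _ : ℕ+ => ρ) fun _ => hdiag)
      fun j => hdiag.comp (measurable_pi_apply j)]
    refine Finset.prod_eq_pow_card fun j _ => ?_
    exact (measurePreserving_eval_infinitePi (fun _ : ℕ+ => ρ) j).lintegral_comp hdiag
  simp only [diagonalSum]
  have hmeas : ∀ u : Finset ℕ+, AEMeasurable (fun x : ℕ+ → D =>
      ENNReal.ofReal (γ u * tensorKernel k u x x)) (Measure.infinitePi fun _ : ℕ+ => ρ) := fun u =>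
    ((measurable_tensorKernel hk u measurable_id measurable_id).const_mul _).ennreal_ofReal.aemeasurable
  rw [lintegral_tsum hmeas]
  simp_rw [hterm]
  rw [← ENNReal.ofReal_tsum_of_nonneg _ hk.summable_weights]
  · exact ENNReal.ofReal_lt_top
  · exact fun u => mul_nonneg (hk.weight_nonneg u)
      (pow_nonneg (integral_nonneg fun x => (hk.diagonal_pos x).le) _)

theorem ae_mem_domain [IsProbabilityMeasure ρ] (hk : StandingAssumptions ρ k γ) :
    ∀ᵐ x ∂(Measure.infinitePi fun _ : ℕ+ => ρ), x ∈ domain k γ := by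
  filter_upwards [ae_lt_top (measurable_diagonalSum hk) (lintegral_diagonalSum_lt_top hk).ne]
    with x hx
  exact (mem_domain_iff hk x).mpr hx

/-- Since $\sqrt t\le 1+\max(t,0)$, `f` is dominated by a multiple of one plus the integrable
diagonal. The free `t` allows for the diagonals of both $K_v$ and $K$. -/
theorem integrable_of_abs_le_sqrt [IsProbabilityMeasure ρ] (hk : StandingAssumptions ρ k γ)
    {f : (ℕ+ → D) → ℝ} (hf : Measurable f) (C : ℝ)
    (hC : ∀ x ∈ domain k γ, ∃ t : ℝ, |f x| ≤ C * √t ∧ ENNReal.ofReal t ≤ diagonalSum k γ x) :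
    Integrable f (Measure.infinitePi fun _ : ℕ+ => ρ) := by
  refine ⟨hf.aestronglyMeasurable, ?_⟩
  have hle : ∫⁻ x, ‖f x‖ₑ ∂(Measure.infinitePi fun _ : ℕ+ => ρ) ≤
      ∫⁻ x, ENNReal.ofReal |C| * (1 + diagonalSum k γ x)
        ∂(Measure.infinitePi fun _ : ℕ+ => ρ) := by
    refine lintegral_mono_ae ?_
    filter_upwards [ae_mem_domain hk] with x hx
    obtain ⟨t, h1, h2⟩ := hC x hx
    have h3 : √t ≤ 1 + max t 0 := by
      refine Real.sqrt_le_iff.mpr ⟨by positivity, ?_⟩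
      nlinarith [le_max_left t 0, le_max_right t 0]
    calc ‖f x‖ₑ = ENNReal.ofReal |f x| := by rw [Real.enorm_eq_ofReal_abs]
      _ ≤ ENNReal.ofReal (|C| * (1 + max t 0)) := ENNReal.ofReal_le_ofReal <| h1.trans <|
          mul_le_mul (le_abs_self C) h3 (Real.sqrt_nonneg _) (abs_nonneg _)
      _ = ENNReal.ofReal |C| * (1 + ENNReal.ofReal t) := by
          rw [ENNReal.ofReal_mul (abs_nonneg _), ENNReal.ofReal_add zero_le_one (by positivity),
            ENNReal.ofReal_one, ENNReal.ofReal_max]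
          simp
      _ ≤ _ := by gcongr
  refine lt_of_le_of_lt hle ?_
  rw [lintegral_const_mul' _ _ ENNReal.ofReal_ne_top,
    lintegral_add_left measurable_const, lintegral_const, measure_univ]
  exact ENNReal.mul_lt_top ENNReal.ofReal_lt_top
    (ENNReal.add_lt_top.mpr ⟨by simp, lintegral_diagonalSum_lt_top hk⟩)

theorem integrable_of_rkhsNorm_partialKernel_lt_top [IsProbabilityMeasure ρ]
    (hk : StandingAssumptions ρ k γ) {v : Finset ℕ+} {f : (ℕ+ → D) → ℝ}
    (hf : rkhsNorm (partialKernel k γ v) f < ∞) :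
    Integrable f (Measure.infinitePi fun _ : ℕ+ => ρ) := by
  obtain ⟨C, hC⟩ := exists_abs_le_of_rkhsNorm_lt_top hf
  refine integrable_of_abs_le_sqrt hk (measurable_of_rkhsNorm_lt_top (fun y => ?_) hf) C
    fun x _ => ⟨_, hC x, ?_⟩
  · exact Finset.measurable_sum _ fun u _ =>
      (measurable_tensorKernel hk u measurable_id measurable_const).const_mul _
  · rw [partialKernel, ENNReal.ofReal_sum_of_nonneg
      fun u _ => mul_tensorKernel_diagonal_nonneg hk u x]
    exact ENNReal.sum_le_tsum _

theorem measurable_fullKernel (hk : StandingAssumptions ρ k γ) (y : domain k γ) :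
    Measurable fun x => fullKernel k γ x y :=
  measurable_of_tendsto_metrizable' atTop
    (f := fun (s : Finset (Finset ℕ+)) (x : domain k γ) =>
      ∑ u ∈ s, γ u * tensorKernel k u (x : ℕ+ → D) (y : ℕ+ → D))
    (fun _ => Finset.measurable_sum _ fun u _ =>
      (measurable_tensorKernel hk u measurable_subtype_coe measurable_const).const_mul _)
    (tendsto_pi_nhds.mpr fun x => (summable_mul_tensorKernel hk x y).hasSum)

theorem integrable_extend_of_rkhsNorm_lt_top [IsProbabilityMeasure ρ]
    (hk : StandingAssumptions ρ k γ) {g : domain k γ → ℝ}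
    (hg : rkhsNorm (fullKernel k γ) g < ∞) :
    Integrable (Function.extend Subtype.val g 0) (Measure.infinitePi fun _ : ℕ+ => ρ) := by
  obtain ⟨C, hC⟩ := exists_abs_le_of_rkhsNorm_lt_top hg
  refine integrable_of_abs_le_sqrt hk ?_ C fun x hx => ?_
  · exact (MeasurableEmbedding.subtype_coe (measurableSet_domain hk)).measurable_extend
      (measurable_of_rkhsNorm_lt_top (measurable_fullKernel hk) hg) measurable_const
  · refine ⟨fullKernel k γ ⟨x, hx⟩ ⟨x, hx⟩, ?_, ?_⟩
    · have := Subtype.val_injective.extend_apply g 0 (⟨x, hx⟩ : domain k γ)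
      rw [this]
      exact hC _
    · rw [fullKernel, ENNReal.ofReal_tsum_of_nonneg
        (fun u => mul_tensorKernel_diagonal_nonneg hk u x) hx]
      exact le_rfl

end WeightedKernels

/-! ### Deterministic algorithms: indistinguishable inputs and masking of the integrand. -/

namespace DetAlgorithm

variable {X : Type*} (A : DetAlgorithm X) {f g : X → ℝ}

theorem values_eq_of_forall_lt {n : ℕ} (h : ∀ i < n, f (A.point f i) = g (A.point f i)) :
    A.values g n = A.values f n := by
  induction n with
  | zero => rfl
  | succ n ih =>
    have h1 := ih fun i hi => h i (hi.trans n.lt_succ_self)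
    have h2 : f (A.node (A.values f n)) = g (A.node (A.values f n)) := h n n.lt_succ_self
    rw [values, values, h1, h2]

/-- Nodes and stopping depend only on the observed values, so both runs coincide up to the time when
the run on `f` stops. -/
theorem result_eq_of_forall_lt (hf : A.Halts f)
    (h : ∀ i < A.count f, f (A.point f i) = g (A.point f i)) : A.result g = A.result f := by
  have hval : ∀ n ≤ A.count f, A.values g n = A.values f n := fun n hn =>
    A.values_eq_of_forall_lt fun i hi => h i (hi.trans_le hn)
  have hhalt : A.halt (A.values f (A.count f)) := Nat.sInf_mem hf
  have hg : A.halt (A.values g (A.count f)) := by rwa [hval _ le_rfl]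
  have hle : A.count g ≤ A.count f := Nat.sInf_le hg
  have hge : A.count f ≤ A.count g := by
    refine Nat.sInf_le ?_
    have hmem : A.count g ∈ {n | A.halt (A.values g n)} := Nat.sInf_mem ⟨_, hg⟩
    rwa [Set.mem_ofPred_eq, hval _ hle] at hmem
  rw [result, result, le_antisymm hle hge, hval _ le_rfl]

theorem mul_cost_one_le_cost {c : X → ℝ≥0∞} {T : ℝ≥0∞} (hc : ∀ x, T ≤ c x) :
    T * A.cost f (fun _ => 1) ≤ A.cost f c := by
  rw [cost, cost, Finset.mul_sum]
  exact Finset.sum_le_sum fun i _ => by simpa using hc _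

/-- The observed values, with the values at sample points outside of `S` replaced by zero. -/
def mask (S : Set X) (l : List ℝ) : List ℝ :=
  l.foldl (fun acc y => acc ++ [S.indicator (fun _ => y) (A.node acc)]) []

/-- The algorithm `A` applied to the integrand times the indicator function of `S`. -/
def indicator (S : Set X) : DetAlgorithm X where
  node l := A.node (A.mask S l)
  halt l := A.halt (A.mask S l)
  out l := A.out (A.mask S l)

/-- The masked history determines each sample point, so membership in `S` is known when a value has
to be replaced. Stopping, sample points, output and cost all transfer through this identity. -/
theorem mask_values_indicator (S : Set X) (f : X → ℝ) (n : ℕ) :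
    A.mask S ((A.indicator S).values f n) = A.values (S.indicator f) n := by
  induction n with
  | zero => rfl
  | succ n ih =>
    have h : ∀ l y, A.mask S (l ++ [y])
        = A.mask S l ++ [S.indicator (fun _ => y) (A.node (A.mask S l))] := fun l y => by
      simp [mask]
    change A.mask S (_ ++ [f (A.node (A.mask S ((A.indicator S).values f n)))]) = _
    rw [h, ih, values]
    rfl

theorem halt_values_indicator (S : Set X) (f : X → ℝ) (n : ℕ) :
    (A.indicator S).halt ((A.indicator S).values f n) ↔ A.halt (A.values (S.indicator f) n) := by
  rw [← A.mask_values_indicator S f n]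
  rfl

theorem halts_indicator (S : Set X) (f : X → ℝ) :
    (A.indicator S).Halts f ↔ A.Halts (S.indicator f) :=
  exists_congr fun n => A.halt_values_indicator S f n

theorem count_indicator (S : Set X) (f : X → ℝ) :
    (A.indicator S).count f = A.count (S.indicator f) := by
  simp only [count, halt_values_indicator]

theorem point_indicator (S : Set X) (f : X → ℝ) (i : ℕ) :
    (A.indicator S).point f i = A.point (S.indicator f) i := by
  rw [point, point, ← A.mask_values_indicator S f i]
  rfl

theorem result_indicator (S : Set X) (f : X → ℝ) :
    (A.indicator S).result f = A.result (S.indicator f) := by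
  rw [result, result, ← A.mask_values_indicator S f, count_indicator]
  rfl

theorem cost_indicator (S : Set X) (f : X → ℝ) (c : X → ℝ≥0∞) :
    (A.indicator S).cost f c = A.cost (S.indicator f) c := by
  simp only [cost, count_indicator, point_indicator]

end DetAlgorithm

/-! ### Randomized algorithms: transfer between classes, Markov's inequality, fooling functions. -/

namespace RandomizedAlgorithm

variable {X : Type*} [MeasurableSpace X] {F F' : Set (X → ℝ)} (Q : RandomizedAlgorithm F)

/-- The randomized algorithm `Q` applied to the integrand times the indicator function of `S`. -/
def indicator (S : Set X) (hF : ∀ f ∈ F', S.indicator f ∈ F) : RandomizedAlgorithm F' where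
  Ω := Q.Ω
  P := Q.P
  alg ω := (Q.alg ω).indicator S
  halts f hf := by simpa only [DetAlgorithm.halts_indicator] using Q.halts _ (hF f hf)
  measurableSet_point f hf i B hB := by
    simpa only [DetAlgorithm.count_indicator, DetAlgorithm.point_indicator]
      using Q.measurableSet_point _ (hF f hf) i B hB
  measurable_result f hf := by
    simpa only [DetAlgorithm.result_indicator] using Q.measurable_result _ (hF f hf)

theorem error_sq (I : (X → ℝ) → ℝ) : Q.error I ^ 2 =
    ⨆ f ∈ F, ∫⁻ ω, ENNReal.ofReal ((I f - (Q.alg ω).result f) ^ 2) ∂Q.P := by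
  rw [error, ← ENNReal.rpow_natCast, ← ENNReal.rpow_mul]
  simp

/-- Used with `S` $=\mathfrak X$: elements of $H(K)$ vanish off $\mathfrak X$ while those of
$H(K_v)$ need not, so an algorithm for $B(K)$ is run on the truncated integrand. -/
theorem minimalError_one_le_error (I : (X → ℝ) → ℝ) {S : Set X}
    (hF : ∀ f ∈ F', S.indicator f ∈ F) (hI : ∀ f ∈ F', I (S.indicator f) = I f) {N : ℝ≥0}
    (hQ : Q.expectedCost (fun _ => 1) ≤ N) :
    minimalError {fun _ => 1} I F' N ≤ Q.error I := by
  refine (iInf₂_le (Q.indicator S hF) ?_).trans ?_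
  · rw [worstCaseCost, iInf_singleton]
    refine le_trans ?_ hQ
    refine iSup₂_le fun f hf => ?_
    refine le_trans (le_of_eq ?_) (le_iSup₂_of_le (S.indicator f) (hF f hf) le_rfl)
    simp only [indicator, DetAlgorithm.cost_indicator]
    rfl
  · refine ENNReal.rpow_le_rpow (iSup₂_le fun f hf => ?_) (by norm_num)
    refine le_trans (le_of_eq ?_) (le_iSup₂_of_le (S.indicator f) (hF f hf) le_rfl)
    simp only [indicator, DetAlgorithm.result_indicator, hI f hf]
    rfl

theorem mul_expectedCost_one_le {c : X → ℝ≥0∞} {T : ℝ≥0∞} (hT : T ≠ ∞) (hc : ∀ x, T ≤ c x) :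
    T * Q.expectedCost (fun _ => 1) ≤ Q.expectedCost c := by
  rw [expectedCost, expectedCost, ENNReal.mul_iSup]
  refine iSup_mono fun f => ?_
  rw [ENNReal.mul_iSup]
  refine iSup_mono fun hf => ?_
  -- Finiteness of `T` makes measurability of the cost unnecessary here.
  rw [← lintegral_const_mul' _ _ hT]
  exact lintegral_mono fun ω => (Q.alg ω).mul_cost_one_le_cost hc

theorem measurableSet_exists_point {f : X → ℝ} (hf : f ∈ F) {B : Set X} (hB : MeasurableSet B) :
    MeasurableSet {ω | ∃ i, i < (Q.alg ω).count f ∧ (Q.alg ω).point f i ∈ B} := by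
  rw [Set.ofPred_exists]
  exact MeasurableSet.iUnion fun i => Q.measurableSet_point f hf i B hB

/-- Markov's inequality for the cost of sampling outside of `S`. -/
theorem measure_exists_point_notMem_le {c : X → ℝ≥0∞} {T : ℝ≥0∞} (hT0 : T ≠ 0) (hT : T ≠ ∞)
    {S : Set X} (hS : MeasurableSet S) (hc : ∀ x ∉ S, T ≤ c x) (hQ : Q.expectedCost c ≤ T / 2)
    {f : X → ℝ} (hf : f ∈ F) :
    Q.P {ω | ∃ i, i < (Q.alg ω).count f ∧ (Q.alg ω).point f i ∈ Sᶜ} ≤ 1 / 2 := by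
  have hle : T * Q.P {ω | ∃ i, i < (Q.alg ω).count f ∧ (Q.alg ω).point f i ∈ Sᶜ} ≤ T / 2 := by
    rw [← lintegral_indicator_const (Q.measurableSet_exists_point hf hS.compl)]
    refine le_trans ?_ ((le_iSup₂_of_le f hf le_rfl).trans hQ)
    refine lintegral_mono fun ω => ?_
    refine Set.indicator_apply_le' (fun hω => ?_) fun _ => zero_le
    obtain ⟨i, hi, hiS⟩ := hω
    exact (hc _ hiS).trans (Finset.single_le_sum
      (f := fun i => c ((Q.alg ω).point f i)) (fun _ _ => zero_le) (Finset.mem_range.mpr hi))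
  rw [ENNReal.le_div_iff_mul_le (by simp) (by simp)]
  rw [ENNReal.le_div_iff_mul_le (by simp) (by simp), mul_assoc] at hle
  rw [← ENNReal.mul_le_mul_iff_right hT0 hT, mul_one]
  exact hle

/-- If `Q` does not distinguish `h` from `-h` with probability at least one half, then its error is
bounded from below. -/
theorem ofReal_sq_div_two_le_error_sq (I : (X → ℝ) → ℝ) {h : X → ℝ} (hF : h ∈ F) (hF' : -h ∈ F)
    (hI : I (-h) = -I h) {S : Set X} (hS : MeasurableSet S) (hS0 : ∀ x ∈ S, h x = 0)
    (hP : Q.P {ω | ∃ i, i < (Q.alg ω).count h ∧ (Q.alg ω).point h i ∈ Sᶜ} ≤ 1 / 2) :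
    ENNReal.ofReal (I h ^ 2) / 2 ≤ Q.error I ^ 2 := by
  rw [error_sq]
  set G : Set Q.Ω := {ω | ∃ i, i < (Q.alg ω).count h ∧ (Q.alg ω).point h i ∈ Sᶜ} with hG
  set s := ⨆ f ∈ F, ∫⁻ ω, ENNReal.ofReal ((I f - (Q.alg ω).result f) ^ 2) ∂Q.P with hs
  have hGm : MeasurableSet G := Q.measurableSet_exists_point hF hS.compl
  have hGc : 1 / 2 ≤ Q.P Gᶜ := by
    rw [prob_compl_eq_one_sub hGm]
    refine le_trans ?_ (tsub_le_tsub_left hP 1)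
    rw [one_div, ENNReal.one_sub_inv_two]
  have hmeas : ∀ f ∈ F, Measurable fun ω => ENNReal.ofReal ((I f - (Q.alg ω).result f) ^ 2) :=
    fun f hf => ((measurable_const.sub (Q.measurable_result f hf)).pow_const 2).ennreal_ofReal
  -- Almost surely on `Gᶜ` both inputs `h` and `-h` yield the same output $r$, and
  -- $(I(h)-r)^2+(-I(h)-r)^2\ge 2I(h)^2$.
  have key : 2 * ENNReal.ofReal (I h ^ 2) * Q.P Gᶜ ≤ 2 * s := by
    calc 2 * ENNReal.ofReal (I h ^ 2) * Q.P Gᶜ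
        = ∫⁻ _ in Gᶜ, 2 * ENNReal.ofReal (I h ^ 2) ∂Q.P := by rw [setLIntegral_const]
      _ ≤ ∫⁻ ω in Gᶜ, (ENNReal.ofReal ((I h - (Q.alg ω).result h) ^ 2) +
            ENNReal.ofReal ((I (-h) - (Q.alg ω).result (-h)) ^ 2)) ∂Q.P := by
          refine setLIntegral_mono_ae ((hmeas h hF).add (hmeas _ hF')).aemeasurable ?_
          filter_upwards [Q.halts h hF] with ω hω hωG
          have hzero : ∀ i < (Q.alg ω).count h, h ((Q.alg ω).point h i) = 0 := fun i hi =>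
            hS0 _ (by_contra fun hiS => hωG ⟨i, hi, hiS⟩)
          have hres : (Q.alg ω).result (-h) = (Q.alg ω).result h :=
            (Q.alg ω).result_eq_of_forall_lt hω fun i hi => by simp [hzero i hi]
          rw [hres, hI, ← ENNReal.ofReal_add (by positivity) (by positivity),
            show (2 : ℝ≥0∞) = ENNReal.ofReal 2 by simp, ← ENNReal.ofReal_mul (by norm_num)]
          exact ENNReal.ofReal_le_ofReal (by nlinarith [sq_nonneg ((Q.alg ω).result h)])
      _ ≤ ∫⁻ ω, (ENNReal.ofReal ((I h - (Q.alg ω).result h) ^ 2) +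
            ENNReal.ofReal ((I (-h) - (Q.alg ω).result (-h)) ^ 2)) ∂Q.P :=
          setLIntegral_le_lintegral _ _
      _ ≤ 2 * s := by
          rw [lintegral_add_left (hmeas h hF), two_mul]
          exact add_le_add (le_iSup₂_of_le h hF le_rfl) (le_iSup₂_of_le (-h) hF' le_rfl)
  rw [mul_assoc, ENNReal.mul_le_mul_iff_right (by simp) (by simp)] at key
  refine le_trans ?_ key
  rw [div_eq_mul_one_div]
  gcongr

end RandomizedAlgorithm

theorem minimalError_antitone {X : Type*} [MeasurableSpace X] (C : Set (X → ℝ≥0∞))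
    (I : (X → ℝ) → ℝ) (F : Set (X → ℝ)) : Antitone (minimalError C I F) := fun _ _ hMN =>
  le_iInf₂ fun Q hQ => iInf₂_le Q (hQ.trans (ENNReal.coe_le_coe.mpr hMN))

theorem le_minimalError_sq {X : Type*} [MeasurableSpace X] {C : Set (X → ℝ≥0∞)}
    {I : (X → ℝ) → ℝ} {F : Set (X → ℝ)} {N : ℝ≥0} {B : ℝ≥0∞}
    (h : ∀ Q : RandomizedAlgorithm F, Q.worstCaseCost C ≤ N → B ≤ Q.error I ^ 2) :
    B ≤ minimalError C I F N ^ 2 := by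
  have hle : B ^ (1 / 2 : ℝ) ≤ minimalError C I F N := le_iInf₂ fun Q hQ => by
    have := ENNReal.rpow_le_rpow (h Q hQ) (show (0 : ℝ) ≤ 1 / 2 by norm_num)
    rwa [← ENNReal.rpow_natCast, ← ENNReal.rpow_mul, Nat.cast_ofNat, mul_one_div_cancel two_ne_zero,
      ENNReal.rpow_one] at this
  have h2 := pow_le_pow_left' hle 2
  rwa [← ENNReal.rpow_natCast, ← ENNReal.rpow_mul, Nat.cast_ofNat, one_div_mul_cancel two_ne_zero,
      ENNReal.rpow_one] at h2

/-! ### The bias bound and the reduction to univariate integration. -/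

section LowerBounds

variable {D : Set ℝ} {ρ : Measure D} {k : D → D → ℝ} {γ : Finset ℕ+ → ℝ}

theorem extend_eq_indicator (f : (ℕ+ → D) → ℝ) :
    Function.extend Subtype.val (f ∘ (Subtype.val : domain k γ → _)) 0
      = (domain k γ).indicator f := by
  ext x
  by_cases hx : x ∈ domain k γ
  · have := Subtype.val_injective.extend_apply (f ∘ Subtype.val) 0 (⟨x, hx⟩ : domain k γ)
    rw [Set.indicator_of_mem hx, this]
    rfl
  · rw [Set.indicator_of_notMem hx, Function.extend_apply' _ _ _ (by simpa using hx)]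
    rfl

theorem indicator_mem_fullBall (hk : StandingAssumptions ρ k γ) {v : Finset ℕ+}
    {f : (ℕ+ → D) → ℝ} (hf : f ∈ rkhsBall (partialKernel k γ v)) :
    (domain k γ).indicator f ∈ fullBall k γ :=
  ⟨f ∘ Subtype.val, (rkhsNorm_fullKernel_le hk v f).trans hf, extend_eq_indicator f⟩

theorem integral_indicator_domain [IsProbabilityMeasure ρ] (hk : StandingAssumptions ρ k γ)
    (f : (ℕ+ → D) → ℝ) : integral ρ ((domain k γ).indicator f) = integral ρ f := by
  refine integral_congr_ae ?_
  filter_upwards [ae_mem_domain hk] with x hx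
  exact Set.indicator_of_mem hx f

theorem measurableSet_affineSubspace (v : Finset ℕ+) (a : ℕ+ → D) :
    MeasurableSet (affineSubspace v a) := by
  have : affineSubspace v a = ⋂ (j : ℕ+) (_ : j ∉ v), (fun x : ℕ+ → D => x j) ⁻¹' {a j} := by
    ext x
    simp [affineSubspace]
  rw [this]
  exact MeasurableSet.iInter fun j => MeasurableSet.iInter fun _ =>
    measurable_pi_apply j (measurableSet_singleton _)

theorem affineSubspace_mono {v w : Finset ℕ+} (h : v ⊆ w) (a : ℕ+ → D) :
    affineSubspace v a ⊆ affineSubspace w a := fun _ hx j hj => hx j fun hjv => hj (h hjv)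

/-- For every `f ∈ B(K)` there is an element of `B(K)` that vanishes on `𝔛_{v,a}` and whose integral
is `(I(f) - I(Ψ_{v,a} f)) / (1 + ‖Ψ_{v,a}‖)`. -/
theorem exists_mem_fullBall_eq_zero_on_affineSubspace [IsProbabilityMeasure ρ]
    (hk : StandingAssumptions ρ k γ) (a : ℕ+ → D) (v : Finset ℕ+)
    (hΨ : anchorProjNorm k γ v a < ∞) {f : (ℕ+ → D) → ℝ} (hf : f ∈ fullBall k γ) :
    ∃ h ∈ fullBall k γ, -h ∈ fullBall k γ ∧ (∀ x ∈ affineSubspace v a, h x = 0) ∧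
      integral ρ h = (1 + (anchorProjNorm k γ v a).toReal)⁻¹ *
        (integral ρ f - integral ρ (anchorProj v a f)) := by
  set n := anchorProjNorm k γ v a with hn
  have hn0 : 0 < 1 + n.toReal := by positivity
  have hfn : rkhsNorm (partialKernel k γ v) (anchorProj v a f) ≤ n := le_iSup₂_of_le f hf le_rfl
  obtain ⟨g, hg, rfl⟩ := hf
  dsimp only at hfn ⊢
  set f := Function.extend Subtype.val g 0 with hfdef
  have hfg : f ∘ Subtype.val = g := funext fun y => Subtype.val_injective.extend_apply g 0 y
  let w : domain k γ → ℝ := (1 + n.toReal)⁻¹ • (g - anchorProj v a f ∘ Subtype.val)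
  -- Triangle inequality: $\|g\|_K\le1$, and $\|\Psi_{v,a}f\|_K\le\|\Psi_{v,a}f\|_{K_v}\le n$ after
  -- restriction to $\mathfrak X$.
  have hsub : rkhsNorm (fullKernel k γ) (g - anchorProj v a f ∘ Subtype.val) ≤ 1 + n :=
    (rkhsNorm_sub_le _ _).trans
      (add_le_add hg ((rkhsNorm_fullKernel_le hk v _).trans hfn))
  have hw : w ∈ rkhsBall (fullKernel k γ) := by
    refine (rkhsNorm_smul_le _ (lt_of_le_of_lt hsub (by simp [hΨ]))).trans ?_
    have henorm : ‖(1 + n.toReal)⁻¹‖ₑ = (1 + n)⁻¹ := by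
      rw [Real.enorm_eq_ofReal (by positivity), ENNReal.ofReal_inv_of_pos hn0,
        ENNReal.ofReal_add zero_le_one ENNReal.toReal_nonneg, ENNReal.ofReal_one,
        ENNReal.ofReal_toReal hΨ.ne]
    rw [henorm]
    refine (mul_le_mul_right hsub _).trans ?_
    exact ENNReal.inv_mul_le_one _
  have hwext : Function.extend Subtype.val w 0
      = (domain k γ).indicator ((1 + n.toReal)⁻¹ • (f - anchorProj v a f)) := by
    rw [← extend_eq_indicator]
    simp only [w, ← hfg]
    rfl
  refine ⟨Function.extend Subtype.val w 0, ⟨w, hw, rfl⟩, ⟨-w, neg_mem_rkhsBall hw, ?_⟩,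
    fun x hx => ?_, ?_⟩
  · ext x
    by_cases hx : ∃ y : domain k γ, y.1 = x
    · obtain ⟨y, rfl⟩ := hx
      simp
    · simp [Function.extend_apply' _ _ _ hx]
  · have hxa : (fun j => if j ∈ v then x j else a j) = x := by
      ext1 j
      split_ifs with hj
      · rfl
      · exact (hx j hj).symm
    have : (f - anchorProj v a f) x = 0 := by
      rw [Pi.sub_apply, anchorProj, hxa, sub_self]
    rw [hwext]
    refine Set.indicator_apply_eq_zero.mpr fun _ => ?_
    rw [Pi.smul_apply, this, smul_zero]
  · rw [hwext, integral_indicator_domain hk, integral, integral, integral]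
    simp only [Pi.smul_apply, Pi.sub_apply]
    rw [integral_smul, integral_sub (integrable_extend_of_rkhsNorm_lt_top hk
      (lt_of_le_of_lt hg ENNReal.one_lt_top))
      (integrable_of_rkhsNorm_partialKernel_lt_top hk (lt_of_le_of_lt hfn hΨ)), smul_eq_mul]

/-- An algorithm that samples in `𝔛_{v,a}` with probability at least one half has an error of the
order of the bias. -/
theorem ofReal_sq_le_error_sq_of_affineSubspace [IsProbabilityMeasure ρ]
    (hk : StandingAssumptions ρ k γ) {a : ℕ+ → D} {v : Finset ℕ+} {β : ℝ}
    (hβ : 0 < β) (hbias : ENNReal.ofReal β ≤ bias ρ k γ v a / (1 + anchorProjNorm k γ v a))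
    (Q : RandomizedAlgorithm (fullBall k γ)) {c : (ℕ+ → D) → ℝ≥0∞} {T : ℝ≥0∞} (hT0 : T ≠ 0)
    (hT : T ≠ ∞) (hc : ∀ x ∉ affineSubspace v a, T ≤ c x) (hQ : Q.expectedCost c ≤ T / 2) :
    ENNReal.ofReal (β ^ 2 / 2) ≤ Q.error (integral ρ) ^ 2 := by
  -- An infinite operator norm would make the quotient in `hbias` zero, even for infinite bias,
  -- against $\beta>0$.
  have hΨ : anchorProjNorm k γ v a < ∞ := by
    by_contra h
    rw [not_lt_top_iff.mp h, add_top, ENNReal.div_top] at hbias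
    exact absurd (ENNReal.ofReal_eq_zero.mp (le_zero_iff.mp hbias)) (not_le.mpr hβ)
  set n := anchorProjNorm k γ v a with hn
  set E := Q.error (integral ρ) ^ 2 with hE
  have hn0 : 0 < 1 + n.toReal := by positivity
  have hn1 : ENNReal.ofReal (1 + n.toReal) = 1 + n := by
    rw [ENNReal.ofReal_add zero_le_one ENNReal.toReal_nonneg, ENNReal.ofReal_one,
      ENNReal.ofReal_toReal hΨ.ne]
  have hle : bias ρ k γ v a ≤ (2 * E) ^ (1 / 2 : ℝ) * (1 + n) := by
    refine iSup₂_le fun f hf => ?_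
    obtain ⟨h, hF, hF', h0, hI⟩ := exists_mem_fullBall_eq_zero_on_affineSubspace hk a v hΨ hf
    have hneg : integral ρ (-h) = -integral ρ h := integral_neg _
    have h1 := Q.ofReal_sq_div_two_le_error_sq (integral ρ) hF hF' hneg
      (measurableSet_affineSubspace v a) h0
      (Q.measure_exists_point_notMem_le hT0 hT (measurableSet_affineSubspace v a) hc hQ hF)
    rw [ENNReal.div_le_iff (by simp) (by simp), mul_comm, ← hE, ← sq_abs,
      ENNReal.ofReal_pow (abs_nonneg _), ← Real.enorm_eq_ofReal_abs] at h1
    have h2 := ENNReal.rpow_le_rpow h1 (show (0 : ℝ) ≤ 1 / 2 by norm_num)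
    rw [← ENNReal.rpow_natCast, ← ENNReal.rpow_mul, Nat.cast_ofNat, mul_one_div_cancel two_ne_zero,
      ENNReal.rpow_one] at h2
    have h3 : integral ρ f - integral ρ (anchorProj v a f)
        = integral ρ h * (1 + n.toReal) := by
      rw [hI, ← hn]
      field_simp
    rw [h3, enorm_mul, Real.enorm_eq_ofReal hn0.le, hn1]
    gcongr
  have h4 := hbias.trans (ENNReal.div_le_of_le_mul hle)
  have h5 := pow_le_pow_left' h4 2
  rw [← ENNReal.rpow_natCast (_ ^ _), ← ENNReal.rpow_mul, Nat.cast_ofNat,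
    one_div_mul_cancel two_ne_zero, ENNReal.rpow_one, ← ENNReal.ofReal_pow hβ.le, mul_comm] at h5
  rw [ENNReal.ofReal_div_of_pos two_pos]
  exact ENNReal.div_le_of_le_mul (by simpa using h5)

/-- Sampling at a cost of at least `T` per evaluation is at least as hard as univariate
integration. -/
theorem partialMinimalError_le_error [IsProbabilityMeasure ρ] (hk : StandingAssumptions ρ k γ)
    (v : Finset ℕ+) (Q : RandomizedAlgorithm (fullBall k γ)) {c : (ℕ+ → D) → ℝ≥0∞}
    {T M : ℝ≥0} (hT0 : 0 < T) (hc : ∀ x, T ≤ c x) (hQ : Q.expectedCost c ≤ M) :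
    partialMinimalError ρ k γ v (M / T) ≤ Q.error (integral ρ) := by
  refine Q.minimalError_one_le_error _ (S := domain k γ)
    (fun f hf => indicator_mem_fullBall hk hf) (fun f _ => integral_indicator_domain hk f) ?_
  have := (Q.mul_expectedCost_one_le ENNReal.coe_ne_top hc).trans hQ
  rw [ENNReal.coe_div hT0.ne', ENNReal.le_div_iff_mul_le (by simp [hT0.ne']) (by simp), mul_comm]
  exact this

end LowerBounds

/-! ### Convergence rates and the choice of subspaces. -/

section Rates

/-- By monotonicity the bound at `b` applies to every smaller `N`. This covers sample numbers that
stay bounded, such as $N/m^s$ for large $m$. -/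
theorem IsOmegaRpowNeg.exists_forall_le {e : ℝ≥0 → ℝ≥0∞} (he : Antitone e) {r : ℝ}
    (h : IsOmegaRpowNeg e r) : ∃ c B : ℝ, 0 < c ∧ 1 ≤ B ∧
      ∀ N : ℝ≥0, ∀ b : ℝ, B ≤ b → N ≤ b → ENNReal.ofReal (c * b ^ (-r)) ≤ e N := by
  obtain ⟨c, hc, h⟩ := h
  obtain ⟨N₀, hN₀⟩ := eventually_atTop.mp h
  refine ⟨c, max 1 N₀, hc, le_max_left _ _, fun N b hb hN => ?_⟩
  have hb0 : 0 ≤ b := zero_le_one.trans ((le_max_left _ _).trans hb)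
  lift b to ℝ≥0 using hb0
  have hNb : N₀ ≤ b := by exact_mod_cast (le_max_right _ _).trans hb
  exact (hN₀ b hNb).trans (he (by exact_mod_cast hN))

theorem isOmegaRpowNeg_of_forall_one_le {e : ℝ≥0 → ℝ≥0∞} {c r : ℝ} (hc : 0 < c)
    (h : ∀ N : ℝ≥0, 1 ≤ N → ENNReal.ofReal (c * (N : ℝ) ^ (-r)) ≤ e N) : IsOmegaRpowNeg e r :=
  ⟨c, hc, (eventually_ge_atTop 1).mono h⟩

theorem sq_mul_rpow_div_two {c m t : ℝ} (hm : 0 ≤ m) :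
    (c * m ^ (-t / 2)) ^ 2 / 2 = c ^ 2 / 2 * m ^ (-t) := by
  rw [mul_pow, ← Real.rpow_natCast (m ^ _), ← Real.rpow_mul hm]
  norm_num
  ring

/-- Trade-off between the dimension `m` of the sampling space and the number `b` of samples. -/
theorem exists_rate_le_of_tradeoff {t s α c₁ c₂ C B : ℝ} (ht : 0 < t) (hs : 0 < s) (hα : 0 < α)
    (hc₁ : 0 < c₁) (hc₂ : 0 < c₂) (hC : 0 < C) (hB : 1 ≤ B) :
    ∃ c, 0 < c ∧ c ≤ c₁ ∧ ∀ N m : ℝ, 1 ≤ N → 1 ≤ m →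
      c * N ^ (-(α * t / (α * s + t))) ≤ c₁ * m ^ (-t) ∨
      ∃ b, B ≤ b ∧ C * N / m ^ s ≤ b ∧ c * N ^ (-(α * t / (α * s + t))) ≤ c₂ * b ^ (-α) := by
  set R := max B C with hR
  have hR0 : 0 < R := lt_of_lt_of_le hC (le_max_right _ _)
  have hq : 0 < α * s + t := by positivity
  refine ⟨min c₁ (c₂ * R ^ (-α)), by positivity, min_le_left _ _, fun N m hN hm => ?_⟩
  have hN0 : 0 < N := by linarith
  have hm0 : 0 < m := by linarith
  -- The threshold solves $m^{-t}=(N/m^s)^{-\alpha}$. Above it, $N/m^s\le N^{t/(\alpha s+t)}$, which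
  -- suggests the choice of `b`.
  rcases le_total m (N ^ (α / (α * s + t))) with h | h
  · left
    have : N ^ (-(α * t / (α * s + t))) ≤ m ^ (-t) := by
      calc N ^ (-(α * t / (α * s + t))) = (N ^ (α / (α * s + t))) ^ (-t) := by
            rw [← Real.rpow_mul hN0.le]
            congr 1
            ring
        _ ≤ m ^ (-t) := Real.rpow_le_rpow_of_nonpos hm0 h (by linarith)
    exact mul_le_mul (min_le_left _ _) this (by positivity) hc₁.le
  · right
    refine ⟨R * N ^ (t / (α * s + t)), ?_, ?_, ?_⟩
    · refine (le_max_left B C).trans (le_mul_of_one_le_right hR0.le ?_)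
      exact Real.one_le_rpow hN (by positivity)
    · rw [div_le_iff₀ (by positivity)]
      have h1 : N ^ (α * s / (α * s + t)) ≤ m ^ s := by
        calc N ^ (α * s / (α * s + t)) = (N ^ (α / (α * s + t))) ^ s := by
              rw [← Real.rpow_mul hN0.le]
              congr 1
              ring
          _ ≤ m ^ s := Real.rpow_le_rpow (by positivity) h hs.le
      have h2 : N = N ^ (t / (α * s + t)) * N ^ (α * s / (α * s + t)) := by
        rw [← Real.rpow_add hN0, ← add_div, add_comm t, div_self hq.ne', Real.rpow_one]
      calc C * N ≤ R * N := by gcongr; exact le_max_right _ _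
        _ = R * (N ^ (t / (α * s + t)) * N ^ (α * s / (α * s + t))) := by rw [← h2]
        _ ≤ R * (N ^ (t / (α * s + t)) * m ^ s) := by gcongr
        _ = _ := by ring
    · refine le_trans (mul_le_mul_of_nonneg_right (min_le_right _ _) (by positivity)) (le_of_eq ?_)
      rw [Real.mul_rpow hR0.le (by positivity), ← Real.rpow_mul hN0.le, mul_assoc]
      congr 3
      ring

/-- Strict growth gives $|v_i|\ge i$, so only finitely many $v_i$ have price below `T`; as the sets
are nested, the last of these contains all the others. -/
theorem exists_affineSubspace_of_variableCost_lt {D : Set ℝ} {price : ℕ → ℝ≥0} {c s : ℝ}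
    (hc : 0 < c) (hs : 0 < s) (hprice : ∀ ν : ℕ, c * (ν : ℝ) ^ s ≤ price ν)
    {v : ℕ → Finset ℕ+} (hv : StrictMono v)
    (hne : ∀ i, (v i).Nonempty) (a : ℕ+ → D) (T : ℝ≥0) :
    ∃ w : Finset ℕ+, w.Nonempty ∧ (w.card : ℝ) ≤ max 1 ((T / c) ^ s⁻¹) ∧
      ∀ x, variableCost price v a x < T → x ∈ affineSubspace w a := by
  have hcard : ∀ i, price (v i).card < T → ((v i).card : ℝ) ≤ (T / c) ^ s⁻¹ := fun i hi => by
    have h1 : c * ((v i).card : ℝ) ^ s ≤ T := (hprice _).trans (by exact_mod_cast hi.le)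
    rw [Real.le_rpow_inv_iff_of_pos (by positivity) (by positivity) hs, le_div_iff₀ hc, mul_comm]
    exact h1
  have hfin : {i | price (v i).card < T}.Finite := by
    refine (Set.finite_Iic ⌊((T : ℝ) / c) ^ s⁻¹⌋₊).subset fun i hi => ?_
    refine Nat.le_floor (le_trans ?_ (hcard i hi))
    exact_mod_cast (Finset.card_strictMono.comp hv).id_le i
  have hex : ∀ x, variableCost price v a x < T →
      ∃ i ∈ {i | price (v i).card < T}, x ∈ affineSubspace (v i) a := fun x hx => by
    simp only [variableCost, iInf_lt_iff] at hx
    obtain ⟨i, hi, hlt⟩ := hx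
    exact ⟨i, by exact_mod_cast hlt, hi⟩
  rcases Set.eq_empty_or_nonempty {i | price (v i).card < T} with h | h
  -- No point has cost below `T`, so any singleton serves; this is why the bound contains the
  -- maximum with one.
  · refine ⟨{1}, Finset.singleton_nonempty _, by simp, fun x hx => ?_⟩
    obtain ⟨i, hi, -⟩ := hex x hx
    exact absurd hi (h ▸ Set.notMem_empty i)
  · obtain ⟨i, hi, hmax⟩ := Set.exists_max_image _ id hfin h
    refine ⟨v i, hne i, (hcard i hi).trans (le_max_right _ _), fun x hx => ?_⟩
    obtain ⟨j, hj, hx⟩ := hex x hx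
    exact affineSubspace_mono (hv.monotone (hmax j hj)) a hx

end Rates

/-! ### Lower bounds for fixed and variable subspace sampling. -/

section LowerBounds

variable {D : Set ℝ} {ρ : Measure D} [IsProbabilityMeasure ρ] {k : D → D → ℝ}
  {γ : Finset ℕ+ → ℝ} {A : Set (ℕ+ → D)} {price : ℕ → ℝ≥0} {s t α c₁ c₂ c₃ B : ℝ}

theorem isOmegaRpowNeg_fixedMinimalError (hk : StandingAssumptions ρ k γ)
    (hs : 0 < s) (ht : 0 < t) (hα : 0 < α) (hc₁ : 0 < c₁)
    (hprice : ∀ ν : ℕ, c₁ * (ν : ℝ) ^ s ≤ price ν) (hc₂ : 0 < c₂)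
    (hbias : ∀ a ∈ A, ∀ v : Finset ℕ+, v.Nonempty → ENNReal.ofReal (c₂ * (v.card : ℝ) ^ (-t / 2)) ≤
        bias ρ k γ v a / (1 + anchorProjNorm k γ v a))
    (hc₃ : 0 < c₃) (hB : 1 ≤ B)
    (huni : ∀ N : ℝ≥0, ∀ b : ℝ, B ≤ b → N ≤ b →
      ENNReal.ofReal (c₃ * b ^ (-α)) ≤ partialMinimalError ρ k γ {1} N ^ 2) :
    IsOmegaRpowNeg (fun N => fixedMinimalError ρ k γ price A N ^ 2) (α * t / (α * s + t)) := by
  obtain ⟨c, hc, hcle, htrade⟩ := exists_rate_le_of_tradeoff (c₁ := c₂ ^ 2 / 2) (c₂ := c₃)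
    (C := 2 / c₁) ht hs hα (by positivity) hc₃ (by positivity) hB
  refine isOmegaRpowNeg_of_forall_one_le hc fun N hN => le_minimalError_sq fun Q hQ => ?_
  have hN0 : 0 < N := lt_of_lt_of_le one_pos hN
  -- The infimum over cost functions need not be attained; the factor two yields a cost function
  -- with expected cost below $2N$.
  have hlt : Q.worstCaseCost (fixedCosts price A) < 2 * N := by
    refine lt_of_le_of_lt hQ ?_
    exact_mod_cast lt_two_mul_self hN0
  simp only [RandomizedAlgorithm.worstCaseCost, iInf_lt_iff] at hlt
  obtain ⟨_, ⟨v, a, ha, rfl⟩, hlt⟩ := hlt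
  -- Points outside $\mathfrak X_{v,a}$ cost $\infty$, so $T=4N$ is admissible in Markov's
  -- inequality. The larger set `w` is needed for $v=\emptyset$, where the bias assumption is
  -- applied to $\{1\}$.
  have hsub : ∀ w : Finset ℕ+, v ⊆ w → w.Nonempty →
      ENNReal.ofReal (c₂ ^ 2 / 2 * (w.card : ℝ) ^ (-t)) ≤ Q.error (integral ρ) ^ 2 :=
    fun w hvw hw => by
      have hw0 : 0 < w.card := hw.card_pos
      rw [← sq_mul_rpow_div_two (by positivity)]
      refine ofReal_sq_le_error_sq_of_affineSubspace hk (by positivity) (hbias a ha w hw) Q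
        (c := fixedCost price v a) (T := 2 * (2 * N)) (by simp [hN0.ne'])
        (by exact_mod_cast ENNReal.coe_ne_top (r := 2 * (2 * N))) (fun x hx => ?_) ?_
      · rw [fixedCost, if_neg fun h => hx (affineSubspace_mono hvw a h)]
        exact le_top
      · refine hlt.le.trans (le_of_eq ?_)
        rw [mul_comm 2 (2 * (N : ℝ≥0∞)), ENNReal.mul_div_cancel_right (by simp) (by simp)]
  have hN1 : (1 : ℝ) ≤ N := by exact_mod_cast hN
  rcases v.eq_empty_or_nonempty with rfl | hv
  · refine le_trans (ENNReal.ofReal_le_ofReal ?_)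
      (hsub {1} (Finset.empty_subset _) (Finset.singleton_nonempty _))
    rw [Finset.card_singleton, Nat.cast_one, Real.one_rpow]
    refine mul_le_mul hcle ?_ (by positivity) (by positivity)
    exact Real.rpow_le_one_of_one_le_of_nonpos hN1 (neg_nonpos.mpr (by positivity))
  · have hm : (1 : ℝ) ≤ v.card := by exact_mod_cast hv.card_pos
    rcases htrade N v.card hN1 hm with h | ⟨b, hb, hNb, h⟩
    · exact (ENNReal.ofReal_le_ofReal h).trans (hsub v subset_rfl hv)
    · have hm0 : (0 : ℝ) < v.card := one_pos.trans_le hm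
      have hp : 0 < price v.card := by
        have : (0 : ℝ) < price v.card := lt_of_lt_of_le (by positivity) (hprice v.card)
        exact_mod_cast this
      -- The number of evaluations is at most $2N/\$(m)\le(2/c_1)N/m^s$ with $m=|v|$, hence `C := 2
      -- / c₁` above.
      have hle := partialMinimalError_le_error hk {1} Q (c := fixedCost price v a) (M := 2 * N) hp
        (fun x => by rw [fixedCost]; split_ifs <;> simp) (by exact_mod_cast hlt.le)
      refine (ENNReal.ofReal_le_ofReal h).trans
        ((huni _ b hb (le_trans ?_ hNb)).trans (pow_le_pow_left' hle 2))
      push_cast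
      rw [div_mul_eq_mul_div, div_div]
      exact div_le_div_of_nonneg_left (by positivity) (by positivity) (hprice _)

theorem isOmegaRpowNeg_variableMinimalError (hk : StandingAssumptions ρ k γ)
    (hs : 0 < s) (ht : 0 < t) (hc₁ : 0 < c₁)
    (hprice : ∀ ν : ℕ, c₁ * (ν : ℝ) ^ s ≤ price ν) (hc₂ : 0 < c₂)
    (hbias : ∀ a ∈ A, ∀ v : Finset ℕ+, v.Nonempty → ENNReal.ofReal (c₂ * (v.card : ℝ) ^ (-t / 2)) ≤
        bias ρ k γ v a / (1 + anchorProjNorm k γ v a))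
    (hc₃ : 0 < c₃) (hB : 1 ≤ B)
    (huni : ∀ N : ℝ≥0, ∀ b : ℝ, B ≤ b → N ≤ b →
      ENNReal.ofReal (c₃ * b ^ (-α)) ≤ partialMinimalError ρ k γ {1} N ^ 2) :
    IsOmegaRpowNeg (fun N => variableMinimalError ρ k γ price A N ^ 2) (min α (t / s)) := by
  have hB0 : 0 < B := one_pos.trans_le hB
  set R := max B (2 / c₁) with hR
  have hR0 : 0 < R := hB0.trans_le (le_max_left _ _)
  set R' := max 1 ((4 / c₁) ^ s⁻¹) with hR'
  have hR'0 : 0 < R' := one_pos.trans_le (le_max_left _ _)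
  refine isOmegaRpowNeg_of_forall_one_le
    (c := min (c₃ * R ^ (-α)) (c₂ ^ 2 / 2 * R' ^ (-t))) (by positivity)
    fun N hN => le_minimalError_sq fun Q hQ => ?_
  have hN0 : 0 < N := lt_of_lt_of_le one_pos hN
  have hN1 : (1 : ℝ) ≤ N := by exact_mod_cast hN
  have hN0' : (0 : ℝ) < N := by exact_mod_cast hN0
  have hlt : Q.worstCaseCost (variableCosts price A) < 2 * N := by
    refine lt_of_le_of_lt hQ ?_
    exact_mod_cast lt_two_mul_self hN0
  simp only [RandomizedAlgorithm.worstCaseCost, iInf_lt_iff] at hlt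
  obtain ⟨_, ⟨v, hv, hne, a, ha, rfl⟩, hlt⟩ := hlt
  -- Both bounds are available for every algorithm; only the one with the smaller exponent is
  -- needed.
  rcases min_choice α (t / s) with h | h
  · rw [h]
    lift c₁ to ℝ≥0 using hc₁.le
    -- As the $v_i$ are non-empty, every evaluation costs at least $c_1|v_i|^s\ge c_1$ for some $i$,
    -- or is infinitely expensive.
    have hle := partialMinimalError_le_error hk {1} Q (c := variableCost price v a) (T := c₁)
      (M := 2 * N) (by exact_mod_cast hc₁) (fun x => le_iInf₂ fun i _ => ?_)
      (by exact_mod_cast hlt.le)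
    · refine le_trans (ENNReal.ofReal_le_ofReal ?_)
        ((huni _ (R * N) ?_ ?_).trans (pow_le_pow_left' hle 2))
      · rw [Real.mul_rpow hR0.le hN0'.le, ← mul_assoc]
        exact mul_le_mul_of_nonneg_right (min_le_left _ _) (by positivity)
      · exact (le_max_left _ _).trans (le_mul_of_one_le_right hR0.le hN1)
      · push_cast
        rw [← div_mul_eq_mul_div]
        exact mul_le_mul_of_nonneg_right (le_max_right _ _) hN0'.le
    · have h1 : (1 : ℝ) ≤ (v i).card := by exact_mod_cast (hne i).card_pos
      have h2 : (c₁ : ℝ) ≤ price (v i).card :=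
        (le_mul_of_one_le_right hc₁.le (Real.one_le_rpow h1 hs.le)).trans (hprice _)
      exact_mod_cast h2
  · rw [h]
    -- Again $T=4N$; then $|w|\le\max\{1,(4N/c_1)^{1/s}\}\le R'N^{1/s}$.
    obtain ⟨w, hw, hwcard, hwx⟩ :=
      exists_affineSubspace_of_variableCost_lt hc₁ hs hprice hv hne a (2 * (2 * N))
    have hw0 : 0 < w.card := hw.card_pos
    have hle := ofReal_sq_le_error_sq_of_affineSubspace hk (by positivity)
      (hbias a ha w hw) Q (c := variableCost price v a) (T := (2 * (2 * N) : ℝ≥0))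
      (by simp [hN0.ne']) ENNReal.coe_ne_top (fun x hx => not_lt.mp fun hx' => hx (hwx x hx'))
      (by
        refine hlt.le.trans (le_of_eq ?_)
        push_cast
        rw [mul_comm 2 (2 * (N : ℝ≥0∞)), ENNReal.mul_div_cancel_right (by simp) (by simp)])
    refine le_trans (ENNReal.ofReal_le_ofReal ?_) hle
    rw [sq_mul_rpow_div_two (by positivity)]
    have hcard : (w.card : ℝ) ≤ R' * (N : ℝ) ^ s⁻¹ := by
      have hNs : 1 ≤ (N : ℝ) ^ s⁻¹ := Real.one_le_rpow hN1 (by positivity)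
      refine hwcard.trans (max_le ?_ ?_)
      · nlinarith [le_max_left 1 ((4 / c₁) ^ s⁻¹)]
      · push_cast
        rw [show 2 * (2 * (N : ℝ)) / c₁ = 4 / c₁ * N by ring,
          Real.mul_rpow (by positivity) hN0'.le]
        exact mul_le_mul_of_nonneg_right (le_max_right _ _) (by positivity)
    calc min (c₃ * R ^ (-α)) (c₂ ^ 2 / 2 * R' ^ (-t)) * (N : ℝ) ^ (-(t / s))
        ≤ c₂ ^ 2 / 2 * R' ^ (-t) * (N : ℝ) ^ (-(t / s)) :=
          mul_le_mul_of_nonneg_right (min_le_right _ _) (by positivity)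
      _ = c₂ ^ 2 / 2 * (R' * (N : ℝ) ^ s⁻¹) ^ (-t) := by
          rw [Real.mul_rpow hR'0.le (by positivity), ← Real.rpow_mul hN0'.le, mul_assoc]
          congr 3
          ring
      _ ≤ c₂ ^ 2 / 2 * (w.card : ℝ) ^ (-t) := by
          gcongr ?_ * ?_
          exact Real.rpow_le_rpow_of_nonpos (by positivity) hcard (by linarith)

end LowerBounds

end InfDimIntegration

end

theorem mainTheorem3 (D : Set ℝ) (ρ : MeasureTheory.Measure D)
    [MeasureTheory.IsProbabilityMeasure ρ] (k : D → D → ℝ) (γ : Finset ℕ+ → ℝ)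
    (hk : InfDimIntegration.StandingAssumptions ρ k γ)
    (A : Set (ℕ+ → D)) (hA : A ⊆ InfDimIntegration.domain k γ)
    (price : ℕ → ℝ≥0) (hprice : Monotone price)
    (s p σ α : ℝ) (hs : 0 < s) (hp : 1 < p) (hσ : 0 < σ) (hα : 0 < α)
    (hpriceΩ : ∃ c : ℝ, 0 < c ∧ ∀ ν : ℕ, c * (ν : ℝ) ^ s ≤ price ν)
    (hbias : ∃ c : ℝ, 0 < c ∧ ∀ a ∈ A, ∀ v : Finset ℕ+, v.Nonempty →
      ENNReal.ofReal (c * (v.card : ℝ) ^ (σ * (1 - p) / 2)) ≤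
        InfDimIntegration.bias ρ k γ v a / (1 + InfDimIntegration.anchorProjNorm k γ v a))
    (hγ : 0 < γ {1})
    (huni : InfDimIntegration.IsOmegaRpowNeg
      (fun N => InfDimIntegration.partialMinimalError ρ k γ {1} N ^ 2) α) :
    InfDimIntegration.IsOmegaRpowNeg
        (fun N => InfDimIntegration.fixedMinimalError ρ k γ price A N ^ 2)
        (α * σ * (p - 1) / (α * s + σ * (p - 1))) ∧
      InfDimIntegration.IsOmegaRpowNeg
        (fun N => InfDimIntegration.variableMinimalError ρ k γ price A N ^ 2)
        (min α (σ * (p - 1) / s)) := by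
  obtain ⟨c₁, hc₁, hprice₁⟩ := hpriceΩ
  obtain ⟨c₂, hc₂, hbias₂⟩ := hbias
  have ht : 0 < σ * (p - 1) := mul_pos hσ (sub_pos.mpr hp)
  have hexp : σ * (1 - p) / 2 = -(σ * (p - 1)) / 2 := by ring
  rw [hexp] at hbias₂
  obtain ⟨c₃, B, hc₃, hB, huni₃⟩ := InfDimIntegration.IsOmegaRpowNeg.exists_forall_le
    (fun _ _ h => pow_le_pow_left' (InfDimIntegration.minimalError_antitone _ _ _ h) 2) huni
  rw [mul_assoc α σ]
  exact ⟨InfDimIntegration.isOmegaRpowNeg_fixedMinimalError hk hs ht hα hc₁ hprice₁ hc₂ hbias₂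
      hc₃ hB huni₃,
    InfDimIntegration.isOmegaRpowNeg_variableMinimalError hk hs ht hc₁ hprice₁ hc₂ hbias₂
      hc₃ hB huni₃⟩
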